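/- Let $m,n\ge 0$ be integers, $M=\{1,\dots,m\}$, $N=\{1,\dots,n\}$. For $i\in M$ let $b_i:[0,\infty)\to\mathbb{R}$ and $l_i:[0,\infty)^m\to\mathbb{R}$ be functions and set $g_i(x)=b_i(x_i)+l_i(x)$ for $x\in[0,\infty)^m$; for $j\in N$ let $h_j:[0,\infty)\to\mathbb{R}$ be a function. (Here $g_i$ is the price function of provider $i$, with offer volume $x_i$; $h_j$ is the price function of user class $j$, with bid volume $y_j$; there are no upper capacity bounds.) Let $$D=\Big\{(x,y)\in[0,\infty)^m\times[0,\infty)^n \ :\ \sum_{i\in M}x_i=\sum_{j\in N}y_j\Big\}.$$ Suppose that $D$ is nonempty, that $g_i$ is continuous on $[0,\infty)^m$ for every $i\in M$, that $h_j$ is continuous on $[0,\infty)$ for every $j\in N$, and that the following coercivity condition holds: (C2) There exists a number $r>0$ such that for every $(x,y)\in D$ and every $j\in N$ with $y_j>r$ there exists $k\in M$ with $x_k>0$ and $g_k(x)\ge h_j(y_j)$. Then there exists $(\bar x,\bar y)\in D$ such that $$\sum_{i\in M}g_i(\bar x)(x_i-\bar x_i)-\sum_{j\in N}h_j(\bar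 y_j)(y_j-\bar y_j)\ \ge\ 0\qquad\text{for all }(x,y)\in D.$$ -/

import Mathlib

/-- The data of the wireless resource allocation market with `m` providers and `n` classes of
users: capacities (possibly `⊤`, i.e. absent), the announced price function `b i` of provider `i`,
the additional dis-utility `l i` of consuming resources of provider `i`, which depends on the whole
offer vector, and the price function `h j` of user class `j`. -/
structure WirelessMarket (m n : ℕ) where
  /-- upper capacity bound of provider `i` -/
  α : Fin m → EReal
  /-- upper capacity bound of user class `j` -/
  β : Fin n → EReal
  /-- announced price function of provider `i` -/
  b : Fin m → ℝ → ℝ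
  /-- dis-utility for users of provider `i` -/
  l : Fin m → (Fin m → ℝ) → ℝ
  /-- price function of user class `j` -/
  h : Fin n → ℝ → ℝ

namespace WirelessMarket

/-- The actual price function of provider `i` for users: `g i x = b i (x i) + l i x`. -/
def g {m n : ℕ} (P : WirelessMarket m n) (i : Fin m) (x : Fin m → ℝ) : ℝ :=
  P.b i (x i) + P.l i x

/-- All capacity bounds are absent. -/
def Unbounded {m n : ℕ} (P : WirelessMarket m n) : Prop :=
  (∀ i, P.α i = ⊤) ∧ (∀ j, P.β j = ⊤)

/-- The offer vectors with `x i ∈ [0, α i]` for all `i`. -/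
def offerBox {m n : ℕ} (P : WirelessMarket m n) : Set (Fin m → ℝ) :=
  {x | ∀ i, 0 ≤ x i ∧ (x i : EReal) ≤ P.α i}

/-- The bid volumes `[0, β j]` of user class `j`. -/
def bidSegment {m n : ℕ} (P : WirelessMarket m n) (j : Fin n) : Set ℝ :=
  {t | 0 ≤ t ∧ (t : EReal) ≤ P.β j}

/-- The feasible set `D` of offer/bid pairs: capacity bounds and the balance equation. -/
def D {m n : ℕ} (P : WirelessMarket m n) : Set ((Fin m → ℝ) × (Fin n → ℝ)) :=
  {w | w.1 ∈ P.offerBox ∧ (∀ j, w.2 j ∈ P.bidSegment j) ∧ ∑ i, w.1 i = ∑ j, w.2 j}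

/-- The coercivity condition. -/
def Coercive {m n : ℕ} (P : WirelessMarket m n) : Prop :=
  ∃ r : ℝ, 0 < r ∧ ∀ x y, (x, y) ∈ P.D → ∀ j : Fin n, r < y j →
    ∃ k : Fin m, 0 < x k ∧ P.g k x ≥ P.h j (y j)

/-- `(x', y')` solves the variational inequality of the market. -/
def SolvesVI {m n : ℕ} (P : WirelessMarket m n) (x' : Fin m → ℝ) (y' : Fin n → ℝ) : Prop :=
  (x', y') ∈ P.D ∧ ∀ x y, (x, y) ∈ P.D →
    0 ≤ ∑ i, P.g i x' * (x i - x' i) - ∑ j, P.h j (y' j) * (y j - y' j)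

end WirelessMarket

/-! A feasible pair solves the inequality as soon as some price `p` clears the market: no offer
price is below `p`, no bid price is above `p`, and active ones equal `p`; the balance equation then
cancels the `p`-terms. The price comes from a covering argument. Truncate bids at `R` and put `z =
(x, R - y)`: the balance equation says that `z` lies on the simplex of sum `n * R`. Cover this
simplex by the sets `A i` where the price in coordinate `i` is least among coordinates that make
sense. The KKM lemma gives a point in the closure of `A i` for every `i` with `0 < z i`, and
continuity turns this into the price comparisons of an equilibrium with bids at most `R`
(`exists_truncated_equilibrium`). With `R` above the coercivity radius, a bid at the truncation
level has price at most that of some active offer, so truncation does no harm.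

KKM follows from Scarf's lemma on finer and finer grids and compactness; Scarf's lemma is a parity
count. -/

section Scarf

/-! ### Scarf's combinatorial lemma -/

variable {I P : Type*}

/-- A set `σ` is dominant for the family of orders on `P` given by the rank functions `v i` if every
`y` lies weakly below all of `σ` in at least one of these orders. -/
def Dominant (v : I → P → ℕ) (σ : Finset P) : Prop :=
  ∀ y, ∃ i, ∀ x ∈ σ, v i y ≤ v i x

theorem Dominant.mono {v : I → P → ℕ} {σ τ : Finset P} (h : Dominant v σ) (hτ : τ ⊆ σ) :
    Dominant v τ := fun y => (h y).imp fun _ hi x hx => hi x (hτ hx)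

/-- `p` is the greatest, in the order `i`, of the elements exceeding the minimum of `τ` in every
other order. -/
def IsReplacement (v : I → P → ℕ) (τ : Finset P) (i : I) (p : P) : Prop :=
  (∀ k, k ≠ i → ∃ x ∈ τ, v k x < v k p) ∧
    ∀ y, (∀ k, k ≠ i → ∃ x ∈ τ, v k x < v k y) → v i y ≤ v i p

theorem exists_isReplacement [Fintype P] {v : I → P → ℕ} {τ : Finset P} {i : I} {q : P}
    (hq : ∀ k, k ≠ i → ∃ x ∈ τ, v k x < v k q) : ∃ p, IsReplacement v τ i p := by
  classical
  obtain ⟨p, hp, hmax⟩ := Finset.exists_max_image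
    (Finset.univ.filter fun y => ∀ k, k ≠ i → ∃ x ∈ τ, v k x < v k y) (v i) ⟨q, by simpa using hq⟩
  refine ⟨p, by simpa using hp, fun y hy => hmax y (by simpa using hy)⟩

theorem IsReplacement.unique {v : I → P → ℕ} (hv : ∀ i, Function.Injective (v i)) {τ : Finset P}
    {i : I} {p q : P} (hp : IsReplacement v τ i p) (hq : IsReplacement v τ i q) : p = q :=
  hv i (le_antisymm (hq.2 _ hp.1) (hp.2 _ hq.1))

/-- A common replacement would exceed the minimum of `τ` in every order, against dominance. -/
theorem IsReplacement.ne {v : I → P → ℕ} {τ : Finset P} (hτ : Dominant v τ)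
    {i j : I} (hij : i ≠ j) {p q : P} (hp : IsReplacement v τ i p) (hq : IsReplacement v τ j q) :
    p ≠ q := by
  rintro rfl
  obtain ⟨k, hk⟩ := hτ p
  by_cases hki : k = i
  · obtain ⟨x, hx, hlt⟩ := hq.1 k (hki ▸ hij)
    exact absurd (hk x hx) (not_le.2 hlt)
  · obtain ⟨x, hx, hlt⟩ := hp.1 k hki
    exact absurd (hk x hx) (not_le.2 hlt)

/-- A dominant set with one element less than there are orders has the same minimum in two orders
`a ≠ b`, and its dominant one-point extensions are by the replacements for `a` and for `b`. -/
theorem Dominant.exists_insert_iff [Fintype I] [DecidableEq P] {v : I → P → ℕ} (hv : ∀ i, Function.Injective (v i))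
    {τ : Finset P} (hτ : Dominant v τ) (hcard : τ.card + 1 = Fintype.card I) (hne : τ.Nonempty) :
    ∃ a b : I, a ≠ b ∧
      (∃ w ∈ τ, (∀ x ∈ τ, v a w ≤ v a x) ∧ ∀ x ∈ τ, v b w ≤ v b x) ∧
      ∀ p, (p ∉ τ ∧ Dominant v (insert p τ)) ↔
        (IsReplacement v τ a p ∨ IsReplacement v τ b p) := by
  classical
  choose f hfmem hfmin using fun i => Finset.exists_min_image τ (v i) hne
  obtain ⟨a, -, b, -, hab, hfab⟩ := Finset.exists_ne_map_eq_of_card_lt_of_maps_to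
    (s := (Finset.univ : Finset I)) (t := τ) (f := f)
    (by rw [Finset.card_univ]; omega) (fun i _ => hfmem i)
  -- the minima for all indices but two cannot exhaust `τ`
  have key : ∀ i k : I, i ≠ k → ¬ ∀ x ∈ τ, ∃ l, l ≠ i ∧ l ≠ k ∧ x = f l := by
    intro i k hik h
    have hsub : τ ⊆ ((Finset.univ.erase i).erase k).image f := by
      intro x hx
      obtain ⟨l, h1, h2, rfl⟩ := h x hx
      exact Finset.mem_image_of_mem _ (by simp [h1, h2])
    have h1 := (Finset.card_le_card hsub).trans Finset.card_image_le
    have h2 : τ.card ≠ 0 := by simpa using hne.ne_empty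
    rw [Finset.card_erase_of_mem (by simp [hik.symm]), Finset.card_erase_of_mem (by simp),
      Finset.card_univ] at h1
    omega
  have hfeq : ∀ x ∈ τ, ∀ i, (∀ z ∈ τ, v i x ≤ v i z) → x = f i := fun x hx i h =>
    hv i (le_antisymm (h _ (hfmem i)) (hfmin i x hx))
  refine ⟨a, b, hab, ⟨f a, hfmem a, hfmin a, by rw [hfab]; exact hfmin b⟩, fun p => ⟨?_, ?_⟩⟩
  · rintro ⟨hp, hdom⟩
    obtain ⟨i, hi⟩ := hdom p
    -- Dominance tested at `x` itself makes `x` the minimum of the enlarged set in some order `l`.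
    have hidx : ∀ x ∈ τ, ∃ l, (∀ z ∈ insert p τ, v l x ≤ v l z) ∧ x = f l := fun x hx => by
      obtain ⟨l, hl⟩ := hdom x
      exact ⟨l, hl, hfeq x hx l fun z hz => hl z (Finset.mem_insert_of_mem hz)⟩
    have hnot : ∀ l, (∀ z ∈ τ, v l p ≤ v l z) → ∀ x ∈ τ, ¬ v l x ≤ v l p := by
      intro l hl x hx h
      exact hp (hv l (le_antisymm (hl x hx) h) ▸ hx)
    have hY : ∀ k, k ≠ i → ∃ x ∈ τ, v k x < v k p := by
      intro k hki
      by_contra! hk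
      refine key i k hki.symm fun x hx => ?_
      obtain ⟨l, hl, hxl⟩ := hidx x hx
      refine ⟨l, ?_, ?_, hxl⟩
      · rintro rfl
        exact hnot l (fun z hz => hi z (Finset.mem_insert_of_mem hz)) x hx
          (hl p (Finset.mem_insert_self _ _))
      · rintro rfl
        exact hnot l hk x hx (hl p (Finset.mem_insert_self _ _))
    have hrep : IsReplacement v τ i p := by
      refine ⟨hY, fun y hy => ?_⟩
      obtain ⟨k, hk⟩ := hdom y
      by_cases hki : k = i
      · exact hki ▸ hk p (Finset.mem_insert_self _ _)
      · obtain ⟨x, hx, hlt⟩ := hy k hki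
        exact absurd (hk x (Finset.mem_insert_of_mem hx)) (not_le.2 hlt)
    by_cases hia : i = a
    · exact Or.inl (hia ▸ hrep)
    by_cases hib : i = b
    · exact Or.inr (hib ▸ hrep)
    -- As `f a = f b`, the index `a` can be traded for `b`, so orders other than `i` and `a` would
    -- account for all of `τ`.
    refine absurd (fun x hx => ?_) (key i a hia)
    obtain ⟨l, hl, hxl⟩ := hidx x hx
    have hli : l ≠ i := by
      rintro rfl
      exact hnot l (fun z hz => hi z (Finset.mem_insert_of_mem hz)) x hx
        (hl p (Finset.mem_insert_self _ _))
    by_cases hla : l = a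
    · exact ⟨b, Ne.symm hib, hab.symm, by rw [hxl, hla, hfab]⟩
    · exact ⟨l, hli, hla, hxl⟩
  · have main : ∀ i j, i ≠ j → f i = f j → IsReplacement v τ i p →
        p ∉ τ ∧ Dominant v (insert p τ) := by
      intro i j hij hfij hrep
      have hpτ : p ∉ τ := by
        intro hp
        obtain ⟨k, hk⟩ := hτ p
        have hpk := hfeq p hp k hk
        have hki : k = i := by
          by_contra hki
          obtain ⟨x, hx, hlt⟩ := hrep.1 k hki
          exact absurd (hk x hx) (not_le.2 hlt)
        obtain ⟨x, hx, hlt⟩ := hrep.1 j hij.symm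
        have := hfmin j x hx
        rw [← hfij, ← hki, ← hpk] at this
        exact absurd this (not_le.2 hlt)
      refine ⟨hpτ, fun y => ?_⟩
      by_contra! hy
      have hyY : ∀ k, k ≠ i → ∃ x ∈ τ, v k x < v k y := by
        intro k hki
        obtain ⟨x, hx, hlt⟩ := hy k
        rcases Finset.mem_insert.1 hx with rfl | hx
        · obtain ⟨z, hz, hlt'⟩ := hrep.1 k hki
          exact ⟨z, hz, hlt'.trans hlt⟩
        · exact ⟨x, hx, hlt⟩
      have hyp := hrep.2 y hyY
      obtain ⟨x, hx, hlt⟩ := hy i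
      rcases Finset.mem_insert.1 hx with rfl | hx
      · omega
      · obtain ⟨k, hk⟩ := hτ p
        have hki : k = i := by
          by_contra hki
          obtain ⟨x, hx, hlt⟩ := hrep.1 k hki
          exact absurd (hk x hx) (not_le.2 hlt)
        have := hk x hx
        rw [hki] at this
        omega
    rintro (h | h)
    · exact main a b hab hfab h
    · exact main b a hab.symm hfab.symm h

/-- In a set that misses some colour, the number of elements whose removal leaves exactly the
colours other than `i₀` is even. -/
theorem even_card_erase_image [Fintype I] [DecidableEq I] [DecidableEq P] {c : P → I} {i₀ : I} {σ : Finset P}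
    (hcard : σ.card = Fintype.card I) (hc : σ.image c ≠ Finset.univ) :
    Even (σ.filter fun x => (σ.erase x).image c = Finset.univ.erase i₀).card := by
  rcases (σ.filter fun x => (σ.erase x).image c = Finset.univ.erase i₀).eq_empty_or_nonempty
    with h0 | ⟨x, hx⟩
  · simp [h0]
  obtain ⟨hxσ, hx⟩ := Finset.mem_filter.1 hx
  have hcx : c x ≠ i₀ := by
    intro h
    apply hc
    rw [← Finset.insert_erase hxσ, Finset.image_insert, hx, h, Finset.insert_erase (by simp)]
  have hinj : Set.InjOn c (σ.erase x) := by
    rw [← Finset.card_image_iff, hx, Finset.card_erase_of_mem hxσ,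
      Finset.card_erase_of_mem (by simp), hcard, Finset.card_univ]
  obtain ⟨x', hx', hcx'⟩ : ∃ x' ∈ σ.erase x, c x' = c x := by
    rw [← Finset.mem_image, hx]; simpa using hcx
  have hxx' : x ≠ x' := (Finset.ne_of_mem_erase hx').symm
  have himg : σ.image c = Finset.univ.erase i₀ := by
    rw [← Finset.insert_erase hxσ, Finset.image_insert, hx, Finset.insert_eq_of_mem]
    simpa using hcx
  -- The only repeated colour is that shared by `x` and `x'`, so removing either of these, and
  -- nothing else, preserves the image.
  have : (σ.filter fun x => (σ.erase x).image c = Finset.univ.erase i₀) = {x, x'} := by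
    ext z
    simp only [Finset.mem_filter, Finset.mem_insert, Finset.mem_singleton]
    constructor
    · rintro ⟨hz, hzc⟩
      by_contra! hne
      obtain ⟨z', hz', hcz⟩ : ∃ z' ∈ σ.erase z, c z' = c z := by
        rw [← Finset.mem_image, hzc, ← himg]; exact Finset.mem_image_of_mem _ hz
      have hz1 : z ∈ σ.erase x := Finset.mem_erase.2 ⟨hne.1, hz⟩
      by_cases hz'x : z' = x
      · exact hne.2 (hinj hz1 hx' (by rw [← hcz, hz'x, hcx']))
      · exact Finset.ne_of_mem_erase hz'
          (hinj (Finset.mem_erase.2 ⟨hz'x, Finset.mem_of_mem_erase hz'⟩) hz1 hcz)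
    · rintro (rfl | rfl)
      · exact ⟨hxσ, hx⟩
      · refine ⟨Finset.mem_of_mem_erase hx', ?_⟩
        rw [← himg]
        refine (Finset.image_subset_image (Finset.erase_subset _ _)).antisymm ?_
        intro i hi
        obtain ⟨w, hw, rfl⟩ := Finset.mem_image.1 hi
        by_cases hwz : w = z
        · rw [hwz, hcx']
          exact Finset.mem_image_of_mem _ (Finset.mem_erase.2 ⟨hxx', hxσ⟩)
        · exact Finset.mem_image_of_mem _ (Finset.mem_erase.2 ⟨hwz, hw⟩)
  rw [this, Finset.card_pair hxx']
  exact even_two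

/-- **Scarf's lemma**. -/
theorem exists_dominant_rainbow [Fintype I] [DecidableEq I] [Nontrivial I] [Fintype P]
    {v : I → P → ℕ} (hv : ∀ i, Function.Injective (v i))
    (e : I → P) (he : ∀ i p, p ≠ e i → v i (e i) < v i p)
    (he' : ∀ i j p, j ≠ i → p ∉ Set.range e → v i p < v i (e j)) (hP : ∃ p, p ∉ Set.range e)
    (c : P → I) (hce : ∀ i, c (e i) = i) :
    ∃ σ : Finset P, Dominant v σ ∧ σ.image c = Finset.univ := by
  classical
  by_contra! hno
  have heinj : Function.Injective e := fun i j h => by rw [← hce i, h, hce]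
  obtain ⟨i₀⟩ : Nonempty I := inferInstance
  set rooms := Finset.univ.filter fun σ : Finset P => Dominant v σ ∧ σ.card = Fintype.card I
  set doors := Finset.univ.filter fun τ : Finset P =>
    Dominant v τ ∧ τ.card + 1 = Fintype.card I ∧ τ.image c = Finset.univ.erase i₀
  set τ₀ : Finset P := (Finset.univ.erase i₀).image e
  -- Incidences of doors and rooms are counted twice. Without a rainbow room every room has evenly
  -- many doors, while every door lies in two rooms except `τ₀`, which lies in one.
  have hcount := Finset.sum_card_bipartiteAbove_eq_sum_card_bipartiteBelow
    (s := doors) (t := rooms) (fun τ σ => τ ⊆ σ)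
  have hrooms : Even (∑ σ ∈ rooms, (doors.bipartiteBelow (fun τ σ => τ ⊆ σ) σ).card) := by
    refine Finset.even_sum _ fun σ hσ => ?_
    simp only [rooms, Finset.mem_filter, Finset.mem_univ, true_and] at hσ
    have := even_card_erase_image (i₀ := i₀) hσ.2 (hno σ hσ.1)
    rw [← Finset.card_image_of_injOn (f := fun x => σ.erase x)] at this
    · refine (congrArg Even (congrArg Finset.card ?_)).mpr this
      ext τ
      simp only [Finset.bipartiteBelow, doors, Finset.mem_filter, Finset.mem_univ, true_and,
        Finset.mem_image]
      constructor
      · rintro ⟨⟨-, hcd, him⟩, hsub⟩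
        obtain ⟨x, hxτ, rfl⟩ := (Finset.exists_eq_insert_iff (s := τ) (t := σ)).2
          ⟨hsub, by omega⟩
        exact ⟨x, ⟨Finset.mem_insert_self _ _, by rwa [Finset.erase_insert hxτ]⟩,
          Finset.erase_insert hxτ⟩
      · rintro ⟨x, ⟨hx, him⟩, rfl⟩
        exact ⟨⟨hσ.1.mono (Finset.erase_subset _ _),
          by rw [Finset.card_erase_add_one hx, hσ.2], him⟩, Finset.erase_subset _ _⟩
    · intro x hx y _ hxy
      by_contra hne
      have hx' : x ∈ σ := (Finset.mem_filter.1 hx).1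
      have : x ∈ σ.erase y := Finset.mem_erase.2 ⟨hne, hx'⟩
      have hxy' : σ.erase x = σ.erase y := hxy
      rw [← hxy'] at this
      simp at this
  have habove : ∀ τ ∈ doors, (rooms.bipartiteAbove (fun τ σ => τ ⊆ σ) τ).card =
      (Finset.univ.filter fun p => p ∉ τ ∧ Dominant v (insert p τ)).card := by
    intro τ hτ
    simp only [doors, Finset.mem_filter, Finset.mem_univ, true_and] at hτ
    rw [← Finset.card_image_of_injOn (f := fun p => insert p τ)]
    · congr 1
      ext σ
      simp only [Finset.bipartiteAbove, rooms, Finset.mem_filter, Finset.mem_univ, true_and,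
        Finset.mem_image]
      constructor
      · rintro ⟨⟨hd, hcd⟩, hsub⟩
        obtain ⟨x, hxτ, rfl⟩ := (Finset.exists_eq_insert_iff (s := τ) (t := σ)).2
          ⟨hsub, by omega⟩
        exact ⟨x, ⟨hxτ, hd⟩, rfl⟩
      · rintro ⟨x, ⟨hx, hd⟩, rfl⟩
        exact ⟨⟨hd, by rw [Finset.card_insert_of_notMem hx, hτ.2.1]⟩, Finset.subset_insert _ _⟩
    · intro x hx y hy hxy
      have hx' := (Finset.mem_filter.1 hx).2.1
      have hxy' : insert x τ = insert y τ := hxy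
      have : x ∈ insert y τ := hxy' ▸ Finset.mem_insert_self _ _
      exact (Finset.mem_insert.1 this).resolve_right hx'
  have hcardI : 1 < Fintype.card I := Fintype.one_lt_card
  have hdoor : ∀ τ ∈ doors, τ ≠ τ₀ → Even (rooms.bipartiteAbove (fun τ σ => τ ⊆ σ) τ).card := by
    intro τ hτ hne
    rw [habove τ hτ]
    simp only [doors, Finset.mem_filter, Finset.mem_univ, true_and] at hτ
    obtain ⟨hd, hcd, him⟩ := hτ
    have hτne : τ.Nonempty := Finset.card_pos.1 (by omega)
    obtain ⟨t, ht, hte⟩ : ∃ t ∈ τ, t ∉ Set.range e := by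
      by_contra! hall
      apply hne
      refine Finset.eq_of_subset_of_card_le ?_ ?_
      · intro x hx
        obtain ⟨i, rfl⟩ := hall x hx
        have : c (e i) ∈ Finset.univ.erase i₀ := him ▸ Finset.mem_image_of_mem c hx
        rw [hce] at this
        exact Finset.mem_image_of_mem e this
      · rw [Finset.card_image_of_injective _ heinj, Finset.card_erase_of_mem (by simp),
          Finset.card_univ]
        omega
    obtain ⟨a, b, hab, ⟨w, hw, hwa, hwb⟩, hiff⟩ := hd.exists_insert_iff hv hcd hτne
    -- The element `t` outside the range of `e` lies below `e i` in every order but `i`. Hence `e i`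
    -- is not the double minimum `w`, and `e i` serves below as a candidate for the replacement.
    have hwe : ∀ i j, i ≠ j → (∀ x ∈ τ, v j w ≤ v j x) → e i ∈ τ → w ≠ e i := by
      rintro i j hij hj - rfl
      exact absurd (hj t ht) (not_le.2 (he' j i t hij hte))
    have hex : ∀ i j, i ≠ j → (∀ x ∈ τ, v i w ≤ v i x) → (∀ x ∈ τ, v j w ≤ v j x) →
        ∃ p, IsReplacement v τ i p := by
      intro i j hij hi hj
      have hei : e i ∉ τ := fun hei =>
        absurd (hi _ hei) (not_le.2 (he i w (hwe i j hij hj hei)))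
      exact exists_isReplacement (q := e i) fun k hk => ⟨t, ht, he' k i t hk.symm hte⟩
    obtain ⟨p, hp⟩ := hex a b hab hwa hwb
    obtain ⟨q, hq⟩ := hex b a hab.symm hwb hwa
    have : (Finset.univ.filter fun p => p ∉ τ ∧ Dominant v (insert p τ)) = {p, q} := by
      ext z
      simp only [Finset.mem_filter, Finset.mem_univ, true_and, hiff, Finset.mem_insert,
        Finset.mem_singleton]
      constructor
      · rintro (h | h)
        · exact Or.inl (h.unique hv hp)
        · exact Or.inr (h.unique hv hq)
      · rintro (rfl | rfl)
        · exact Or.inl hp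
        · exact Or.inr hq
    rw [this, Finset.card_pair (hp.ne hd hab hq)]
    exact even_two
  have hτ₀card : τ₀.card + 1 = Fintype.card I := by
    rw [Finset.card_image_of_injective _ heinj, Finset.card_erase_add_one (by simp),
      Finset.card_univ]
  have hτ₀dom : Dominant v τ₀ := by
    intro y
    by_cases hy : y ∈ Set.range e
    · obtain ⟨i, rfl⟩ := hy
      refine ⟨i, fun x _ => ?_⟩
      by_cases hx : x = e i
      · rw [hx]
      · exact (he i x hx).le
    · refine ⟨i₀, fun x hx => ?_⟩
      obtain ⟨i, hi, rfl⟩ := Finset.mem_image.1 hx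
      exact (he' i₀ i y (Finset.ne_of_mem_erase hi) hy).le
  have hτ₀ : τ₀ ∈ doors := by
    simp only [doors, Finset.mem_filter, Finset.mem_univ, true_and]
    refine ⟨hτ₀dom, hτ₀card, ?_⟩
    rw [Finset.image_image, show c ∘ e = id from funext hce, Finset.image_id]
  have hodd : (rooms.bipartiteAbove (fun τ σ => τ ⊆ σ) τ₀).card = 1 := by
    rw [habove τ₀ hτ₀]
    have hτne : τ₀.Nonempty := Finset.card_pos.1 (by omega)
    obtain ⟨a, b, hab, ⟨w, hw, hwa, hwb⟩, hiff⟩ := hτ₀dom.exists_insert_iff hv hτ₀card hτne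
    have hmem : ∀ i, i ≠ i₀ → e i ∈ τ₀ := fun i hi => Finset.mem_image_of_mem e (by simpa using hi)
    have hmin : ∀ i, i ≠ i₀ → (∀ x ∈ τ₀, v i w ≤ v i x) → w = e i := by
      intro i hi h
      by_contra hwi
      exact absurd (h _ (hmem i hi)) (not_le.2 (he i w hwi))
    obtain ⟨p₀, hp₀⟩ := hP
    have hi₀ : ∃ p, IsReplacement v τ₀ i₀ p :=
      exists_isReplacement (q := p₀) fun k hk =>
        ⟨e k, hmem k hk, he k p₀ fun h => hp₀ ⟨k, h.symm⟩⟩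
    obtain ⟨p, hp⟩ := hi₀
    -- The double minimum of `τ₀` is some `e j` shared with order `i₀`. A replacement for `j` would
    -- have to exceed `e j` in order `i₀` and each `e k`, for `k` other than `i₀` and `j`, in order
    -- `k`; no element does.
    have hother : ∀ j, j ≠ i₀ → w = e j → (∀ x ∈ τ₀, v i₀ w ≤ v i₀ x) →
        ∀ q, ¬ IsReplacement v τ₀ j q := by
      intro j hj hwj hwmin q hq
      have hgt : v i₀ w < v i₀ q := by
        obtain ⟨x, hx, hlt⟩ := hq.1 i₀ hj.symm
        exact (hwmin x hx).trans_lt hlt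
      by_cases hqe : q ∈ Set.range e
      · obtain ⟨k, rfl⟩ := hqe
        by_cases hk : k = i₀
        · subst hk
          have := he k w (by rw [hwj]; exact fun h => hj (heinj h))
          omega
        · by_cases hkj : k = j
          · subst hkj
            rw [hwj] at hgt
            exact lt_irrefl _ hgt
          · obtain ⟨x, hx, hlt⟩ := hq.1 k hkj
            by_cases hxk : x = e k
            · rw [hxk] at hlt
              exact lt_irrefl _ hlt
            · exact absurd (he k x hxk) (not_lt.2 hlt.le)
      · have := he' i₀ j q hj hqe
        rw [← hwj] at this
        omega
    have hsingle : (Finset.univ.filter fun p => p ∉ τ₀ ∧ Dominant v (insert p τ₀)) = {p} := by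
      ext z
      simp only [Finset.mem_filter, Finset.mem_univ, true_and, hiff, Finset.mem_singleton]
      by_cases ha : a = i₀
      · subst ha
        have hb := hother b hab.symm (hmin b hab.symm hwb) hwa z
        exact ⟨fun h => (h.resolve_right hb).unique hv hp, fun h => Or.inl (h ▸ hp)⟩
      · by_cases hb : b = i₀
        · subst hb
          have ha' := hother a hab (hmin a hab hwa) hwb z
          exact ⟨fun h => (h.resolve_left ha').unique hv hp, fun h => Or.inr (h ▸ hp)⟩
        · exact absurd (heinj ((hmin a ha hwa).symm.trans (hmin b hb hwb))) hab
    rw [hsingle, Finset.card_singleton]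
  rw [← hcount, ← Finset.add_sum_erase _ _ hτ₀, hodd] at hrooms
  have heven : Even (∑ τ ∈ doors.erase τ₀, (rooms.bipartiteAbove (fun τ σ => τ ⊆ σ) τ).card) :=
    Finset.even_sum _ fun τ hτ =>
      hdoor τ (Finset.mem_of_mem_erase hτ) (Finset.ne_of_mem_erase hτ)
  rw [Nat.even_add] at hrooms
  exact absurd (hrooms.2 heven) (by decide)

end Scarf

/-! ### From Scarf's lemma to the KKM lemma -/

section KnasterKuratowskiMazurkiewicz

open Filter Topology

variable {I : Type*} [Fintype I]

/-- Scarf's lemma on the grid of nonnegative integer vectors with sum `N`. -/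
theorem exists_grid_point [DecidableEq I] [Nontrivial I] (N : ℕ) (c : (I → ℕ) → I) :
    ∃ t : I → ℕ, ∑ i, t i = N ∧ ∀ i, t i ≤ Fintype.card I ∨
      ∃ s : I → ℕ, ∑ i, s i = N ∧ c s = i ∧
        ∀ k, s k ≤ t k + Fintype.card I ∧ t k ≤ s k + Fintype.card I := by
  classical
  obtain ⟨i₀⟩ : Nonempty I := inferInstance
  let T := {t : I → ℕ // t ∈ Finset.piAntidiag (Finset.univ : Finset I) N}
  have hsum : ∀ t : T, ∑ i, t.1 i = N := fun t => (Finset.mem_piAntidiag.1 t.2).1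
  let K := Fintype.card T
  let r : T → ℕ := fun t => Fintype.equivFin T t
  let q : I → ℕ := fun i => Fintype.equivFin I i
  have hr : ∀ t, r t < K := fun t => (Fintype.equivFin T t).2
  have hrinj : Function.Injective r := fun s t h =>
    (Fintype.equivFin T).injective (Fin.ext h)
  have hqinj : Function.Injective q := fun s t h =>
    (Fintype.equivFin I).injective (Fin.ext h)
  -- The `i`-th coordinate, with ties broken by the enumeration `r < K`.
  let u : I → T → ℕ := fun i t => t.1 i * K + r t
  have hule : ∀ i s t, u i s ≤ u i t → s.1 i ≤ t.1 i := by
    intro i s t h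
    by_contra! hlt
    have h1 : (t.1 i + 1) * K ≤ s.1 i * K := Nat.mul_le_mul_right _ hlt
    have h2 := hr t
    simp only [u] at h
    rw [Nat.add_mul] at h1
    omega
  have huinj : ∀ i, Function.Injective (u i) := by
    intro i s t h
    have h1 := (hule i s t h.le).antisymm (hule i t s h.ge)
    apply hrinj
    simp only [u, h1] at h
    omega
  have hub : ∀ i t, u i t < (N + 1) * K := by
    intro i t
    have h1 : t.1 i ≤ N := (Finset.single_le_sum (f := t.1) (fun _ _ => Nat.zero_le _)
      (Finset.mem_univ i)).trans_eq (hsum t)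
    have h2 := Nat.mul_le_mul_right K h1
    have h3 := hr t
    simp only [u]
    rw [Nat.add_mul]
    omega
  -- The added point `Sum.inr j` stands for the face `t j = 0`: it is lowest in order `j` and above
  -- all grid points in the other orders.
  let v : I → T ⊕ I → ℕ := fun i => Sum.elim (fun t => u i t + 1)
    (fun j => if j = i then 0 else (N + 1) * K + 1 + q j)
  have hv : ∀ i, Function.Injective (v i) := by
    rintro i (s | j) (t | k) h
    · simp only [v, Sum.elim_inl, add_left_inj] at h
      exact congrArg _ (huinj i h)
    · simp only [v, Sum.elim_inl, Sum.elim_inr] at h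
      have := hub i s
      split_ifs at h
      all_goals omega
    · simp only [v, Sum.elim_inl, Sum.elim_inr] at h
      have := hub i t
      split_ifs at h
      all_goals omega
    · simp only [v, Sum.elim_inr] at h
      split_ifs at h with h1 h2
      · rw [h1, h2]
      · omega
      · omega
      · exact congrArg _ (hqinj (by omega))
  have hrange : ∀ p : T ⊕ I, p ∉ Set.range (Sum.inr : I → T ⊕ I) → ∃ t, p = Sum.inl t := by
    rintro (t | j) h
    · exact ⟨t, rfl⟩
    · exact absurd ⟨j, rfl⟩ h
  have hT : ∀ t : I → ℕ, ∑ i, t i = N → t ∈ Finset.piAntidiag (Finset.univ : Finset I) N :=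
    fun t ht => Finset.mem_piAntidiag.2 ⟨ht, fun _ _ => Finset.mem_univ _⟩
  let t₁ : T := ⟨Pi.single i₀ N, hT _ (by simp)⟩
  obtain ⟨σ, hdom, hcol⟩ := exists_dominant_rainbow hv Sum.inr
    (by
      rintro i (t | j) h
      · simp [v]
      · have : j ≠ i := fun h' => h (h' ▸ rfl)
        simp [v, this])
    (by
      rintro i j p hji hp
      obtain ⟨t, rfl⟩ := hrange p hp
      have := hub i t
      simp only [v, Sum.elim_inl, Sum.elim_inr, if_neg hji]
      omega)
    ⟨Sum.inl t₁, by simp⟩ (Sum.elim (fun t => c t.1) id) (fun _ => rfl)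
  have hge : ∀ t i, (∀ x ∈ σ, v i (Sum.inl t) ≤ v i x) →
      Sum.inr i ∉ σ ∧ ∀ s : T, Sum.inl s ∈ σ → t.1 i ≤ s.1 i := by
    refine fun t i h => ⟨fun hi => ?_, fun s hs => hule i t s ?_⟩
    · simpa [v] using h _ hi
    · simpa [v] using h _ hs
  obtain ⟨t₀, ht₀⟩ : ∃ t₀ : T, Sum.inl t₀ ∈ σ := by
    obtain ⟨i, hi⟩ := hdom (Sum.inl t₁)
    have hiσ := (hge t₁ i hi).1
    have : i ∈ σ.image (Sum.elim (fun t : T => c t.1) id) := by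
      rw [hcol]; exact Finset.mem_univ i
    obtain ⟨x, hx, hxi⟩ := Finset.mem_image.1 this
    rcases x with t | j
    · exact ⟨t, hx⟩
    · exact absurd hx (by rw [show j = i from hxi]; exact hiσ)
  have hmin : ∀ i, ∃ a, (∀ s : T, Sum.inl s ∈ σ → a ≤ s.1 i) ∧
      ((Sum.inr i ∈ σ ∧ a = 0) ∨ Sum.inr i ∉ σ ∧ ∃ s : T, Sum.inl s ∈ σ ∧ s.1 i = a) := by
    intro i
    by_cases hi : Sum.inr i ∈ σ
    · exact ⟨0, fun _ _ => Nat.zero_le _, Or.inl ⟨hi, rfl⟩⟩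
    · obtain ⟨s, hs, hsmin⟩ := Finset.exists_min_image
        (Finset.univ.filter fun s : T => Sum.inl s ∈ σ) (fun s => s.1 i) ⟨t₀, by simpa using ht₀⟩
      exact ⟨s.1 i, fun t ht => hsmin t (by simpa using ht), Or.inr ⟨hi, s, by simpa using hs, rfl⟩⟩
  choose a ha ha' using hmin
  -- Otherwise `a + 1`, topped up to sum `N`, is a grid point beating the minimum of `σ` in every
  -- order. Thus the grid points in `σ` exceed `a` by less than `card I` in total.
  have hN : N < ∑ i, (a i + 1) := by
    by_contra! hle
    have hy : ∑ i, (a i + 1 + (Pi.single i₀ (N - ∑ i, (a i + 1)) : I → ℕ) i) = N := by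
      rw [Finset.sum_add_distrib, Finset.sum_pi_single' i₀, if_pos (Finset.mem_univ _)]
      omega
    obtain ⟨i, hi⟩ := hdom (Sum.inl ⟨_, hT _ hy⟩)
    obtain ⟨h1, h2⟩ := hge _ i hi
    rcases ha' i with ⟨h, -⟩ | ⟨-, s, hs, hsa⟩
    · exact h1 h
    · have := h2 s hs
      simp only at this
      omega
  have hclose : ∀ s : T, Sum.inl s ∈ σ → ∀ i, s.1 i ≤ a i + Fintype.card I := by
    intro s hs i
    have h1 : ∑ k, (s.1 k - a k) + ∑ k, a k = N := by
      rw [← Finset.sum_add_distrib]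
      refine Eq.trans ?_ (hsum s)
      exact Finset.sum_congr rfl fun k _ => Nat.sub_add_cancel (ha k s hs)
    have h2 := Finset.single_le_sum (f := fun k => s.1 k - a k) (fun _ _ => Nat.zero_le _)
      (Finset.mem_univ i)
    rw [Finset.sum_add_distrib, Finset.sum_const, Finset.card_univ, smul_eq_mul, mul_one] at hN
    omega
  refine ⟨t₀.1, hsum t₀, fun i => ?_⟩
  have : i ∈ σ.image (Sum.elim (fun t : T => c t.1) id) := by
    rw [hcol]; exact Finset.mem_univ i
  obtain ⟨x, hx, hxi⟩ := Finset.mem_image.1 this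
  rcases x with s | j
  · refine Or.inr ⟨s.1, hsum s, hxi, fun k => ?_⟩
    have h1 := hclose s hx k
    have h2 := hclose t₀ ht₀ k
    have h3 := ha k s hx
    have h4 := ha k t₀ ht₀
    omega
  · left
    obtain rfl : j = i := hxi
    have h := ((ha' j).resolve_right fun h => h.1 hx).2
    simpa [h] using hclose t₀ ht₀ j

/-- **Knaster–Kuratowski–Mazurkiewicz lemma**, in the following form: if sets `A i` cover the
simplex of nonnegative vectors with sum `S`, then some point `z` of the simplex lies in the closure
of `A i` for every `i` with `0 < z i`. -/
theorem exists_forall_mem_closure_of_cover [Nonempty I] {S : ℝ} (hS : 0 ≤ S)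
    (A : I → Set (I → ℝ)) (hA : ∀ z : I → ℝ, (∀ i, 0 ≤ z i) → ∑ i, z i = S → ∃ i, z ∈ A i) :
    ∃ z : I → ℝ, (∀ i, 0 ≤ z i) ∧ ∑ i, z i = S ∧ ∀ i, 0 < z i → z ∈ closure (A i) := by
  classical
  rcases subsingleton_or_nontrivial I with hI | hI
  · obtain ⟨i₀⟩ : Nonempty I := inferInstance
    have hz : ∑ _i : I, S = S := by
      rw [Fintype.sum_subsingleton _ i₀]
    obtain ⟨i, hi⟩ := hA (fun _ => S) (fun _ => hS) hz
    exact ⟨fun _ => S, fun _ => hS, hz, fun j _ => subset_closure (Subsingleton.elim i j ▸ hi)⟩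
  let Δ : Set (I → ℝ) := {z | (∀ i, 0 ≤ z i) ∧ ∑ i, z i = S}
  have hΔ : IsCompact Δ := by
    refine (isCompact_univ_pi fun _ : I => isCompact_Icc (a := (0 : ℝ)) (b := S)).of_isClosed_subset
      ?_ ?_
    · have h1 : IsClosed {z : I → ℝ | ∀ i, 0 ≤ z i} := by
        simp only [Set.ofPred_forall]
        exact isClosed_iInter fun i => isClosed_le continuous_const (continuous_apply i)
      exact h1.inter (isClosed_eq (by fun_prop) continuous_const)
    · rintro z ⟨h0, hs⟩ i -
      exact ⟨h0 i, hs ▸ Finset.single_le_sum (f := z) (fun k _ => h0 k) (Finset.mem_univ i)⟩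
  -- Grids of sum `N + 1` avoid division by zero.
  let pt : ℕ → (I → ℕ) → I → ℝ := fun N t i => S / (N + 1) * t i
  have hpt : ∀ N t, ∑ i, t i = N + 1 → pt N t ∈ Δ := by
    refine fun N t ht => ⟨fun i => by positivity, ?_⟩
    have h : (∑ i, (t i : ℝ)) = N + 1 := by exact_mod_cast ht
    simp only [pt]
    rw [← Finset.mul_sum, h]
    field_simp
  let ε : ℕ → ℝ := fun N => S / (N + 1) * Fintype.card I
  have hε : Tendsto ε atTop (𝓝 0) := by
    have h := (tendsto_one_div_add_atTop_nhds_zero_nat (𝕜 := ℝ)).const_mul (S * Fintype.card I)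
    rw [mul_zero] at h
    refine h.congr fun N => ?_
    simp only [ε]
    ring
  have happrox : ∀ N : ℕ, ∃ z ∈ Δ, ∀ i, z i ≤ ε N ∨ ∃ w ∈ A i, dist w z ≤ ε N := by
    intro N
    have hcol : ∀ t : I → ℕ, ∃ i, ∑ i, t i = N + 1 → pt N t ∈ A i := by
      intro t
      by_cases ht : ∑ i, t i = N + 1
      · obtain ⟨i, hi⟩ := hA _ (hpt N t ht).1 (hpt N t ht).2
        exact ⟨i, fun _ => hi⟩
      · exact ⟨Classical.arbitrary I, fun h => absurd h ht⟩
    choose c hc using hcol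
    obtain ⟨t, ht, htc⟩ := exists_grid_point (N + 1) c
    refine ⟨pt N t, hpt N t ht, fun i => (htc i).imp (fun h => ?_) ?_⟩
    · exact mul_le_mul_of_nonneg_left (by exact_mod_cast h) (by positivity)
    · rintro ⟨s, hs, hsi, hst⟩
      refine ⟨pt N s, hsi ▸ hc s hs, (dist_pi_le_iff (by positivity)).2 fun k => ?_⟩
      rw [Real.dist_eq]
      simp only [pt]
      rw [← mul_sub, abs_mul, abs_of_nonneg (by positivity : 0 ≤ S / ((N : ℝ) + 1))]
      refine mul_le_mul_of_nonneg_left (abs_sub_le_iff.2 ⟨?_, ?_⟩) (by positivity)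
      · have := (hst k).1
        rw [sub_le_iff_le_add']
        exact_mod_cast this
      · have := (hst k).2
        rw [sub_le_iff_le_add']
        exact_mod_cast this
  choose z hzΔ hz using happrox
  obtain ⟨z₀, hz₀, φ, hφ, hlim⟩ := hΔ.tendsto_subseq hzΔ
  refine ⟨z₀, hz₀.1, hz₀.2, fun i hi => Metric.mem_closure_iff.2 fun δ hδ => ?_⟩
  have h1 : ∀ᶠ N in atTop, ε (φ N) < z (φ N) i :=
    (hε.comp hφ.tendsto_atTop).eventually_lt ((continuous_apply i).continuousAt.tendsto.comp hlim) hi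
  have h2 : ∀ᶠ N in atTop, ε (φ N) < δ / 2 :=
    (hε.comp hφ.tendsto_atTop).eventually_lt_const (half_pos hδ)
  have h3 : ∀ᶠ N in atTop, dist (z (φ N)) z₀ < δ / 2 := Metric.tendsto_nhds.1 hlim _ (half_pos hδ)
  obtain ⟨N, h1, h2, h3⟩ := (h1.and (h2.and h3)).exists
  obtain ⟨w, hw, hwz⟩ := (hz (φ N) i).resolve_left (not_le.2 h1)
  refine ⟨w, hw, ?_⟩
  rw [dist_comm]
  linarith [dist_triangle w (z (φ N)) z₀]

end KnasterKuratowskiMazurkiewicz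

/-! ### Market equilibrium -/

namespace WirelessMarket

open Filter Topology

variable {m n : ℕ} {P : WirelessMarket m n}

theorem Unbounded.mem_offerBox (h : P.Unbounded) {x : Fin m → ℝ} :
    x ∈ P.offerBox ↔ ∀ i, 0 ≤ x i := by
  simp [offerBox, h.1]

theorem Unbounded.mem_bidSegment (h : P.Unbounded) {j : Fin n} {t : ℝ} :
    t ∈ P.bidSegment j ↔ 0 ≤ t := by
  simp [bidSegment, h.2]

theorem Unbounded.mem_D (h : P.Unbounded) {x : Fin m → ℝ} {y : Fin n → ℝ} :
    (x, y) ∈ P.D ↔ (∀ i, 0 ≤ x i) ∧ (∀ j, 0 ≤ y j) ∧ ∑ i, x i = ∑ j, y j := by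
  simp [D, h.mem_offerBox, h.mem_bidSegment]

/-- A feasible pair supported by a market-clearing price `p` solves the variational inequality. -/
theorem Unbounded.solvesVI_of_price (hunb : P.Unbounded) {x' : Fin m → ℝ} {y' : Fin n → ℝ}
    (hD : (x', y') ∈ P.D) (p : ℝ) (hg : ∀ i, p ≤ P.g i x') (hg' : ∀ i, 0 < x' i → P.g i x' ≤ p)
    (hh : ∀ j, P.h j (y' j) ≤ p) (hh' : ∀ j, 0 < y' j → p ≤ P.h j (y' j)) :
    P.SolvesVI x' y' := by
  refine ⟨hD, fun x y hxy => ?_⟩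
  obtain ⟨hx', hy', hs'⟩ := hunb.mem_D.1 hD
  obtain ⟨hx, hy, hs⟩ := hunb.mem_D.1 hxy
  have h1 : ∑ i, p * (x i - x' i) ≤ ∑ i, P.g i x' * (x i - x' i) := by
    refine Finset.sum_le_sum fun i _ => ?_
    rcases (hx' i).eq_or_lt with h | h
    · exact mul_le_mul_of_nonneg_right (hg i) (by linarith [hx i])
    · rw [le_antisymm (hg' i h) (hg i)]
  have h2 : ∑ j, P.h j (y' j) * (y j - y' j) ≤ ∑ j, p * (y j - y' j) := by
    refine Finset.sum_le_sum fun j _ => ?_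
    rcases (hy' j).eq_or_lt with h | h
    · exact mul_le_mul_of_nonneg_right (hh j) (by linarith [hy j])
    · rw [le_antisymm (hh j) (hh' j h)]
  rw [← Finset.mul_sum, Finset.sum_sub_distrib, hs, hs'] at h1
  rw [← Finset.mul_sum, Finset.sum_sub_distrib] at h2
  linarith

/-- With bids truncated at `R`, there is a feasible pair at which every active offer price is at
most every offer price and every positive bid price, and every bid price below the truncation is
at most every offer price. -/
theorem Unbounded.exists_truncated_equilibrium (hunb : P.Unbounded) (hm : 0 < m)
    (hg : ∀ i, ContinuousOn (P.g i) P.offerBox)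
    (hh : ∀ j, ContinuousOn (P.h j) (P.bidSegment j)) {R : ℝ} (hR : 0 ≤ R) :
    ∃ (x : Fin m → ℝ) (y : Fin n → ℝ), (x, y) ∈ P.D ∧ (∀ j, y j ≤ R) ∧
      (∀ i k, 0 < x i → P.g i x ≤ P.g k x) ∧
      (∀ i j, 0 < x i → 0 < y j → P.g i x ≤ P.h j (y j)) ∧
      (∀ i j, y j < R → P.h j (y j) ≤ P.g i x) := by
  have : Nonempty (Fin m) := ⟨⟨0, hm⟩⟩
  -- A bid coordinate counts only while `R - z (Sum.inr j)` is a nonnegative bid. Offers always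
  -- count, so with `0 < m` the minimum defining the cover exists.
  let avail : (Fin m ⊕ Fin n → ℝ) → Fin m ⊕ Fin n → Prop := fun z =>
    Sum.elim (fun _ => True) (fun j => z (Sum.inr j) ≤ R)
  let G : (Fin m ⊕ Fin n → ℝ) → Fin m ⊕ Fin n → ℝ := fun z =>
    Sum.elim (fun i => P.g i fun k => z (Sum.inl k)) (fun j => P.h j (R - z (Sum.inr j)))
  let dom : Fin m ⊕ Fin n → Set (Fin m ⊕ Fin n → ℝ) := fun l => {z | (∀ k, 0 ≤ z k) ∧ avail z l}
  have hG : ∀ l, ContinuousOn (fun z => G z l) (dom l) := by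
    rintro (i | j)
    · exact (hg i).comp (f := fun z : Fin m ⊕ Fin n → ℝ => fun k => z (Sum.inl k))
        (by fun_prop) fun z hz => hunb.mem_offerBox.2 fun k => hz.1 _
    · exact (hh j).comp (f := fun z : Fin m ⊕ Fin n → ℝ => R - z (Sum.inr j))
        (by fun_prop) fun z hz => hunb.mem_bidSegment.2 (sub_nonneg.2 hz.2)
  let A : Fin m ⊕ Fin n → Set (Fin m ⊕ Fin n → ℝ) := fun i =>
    {z | z ∈ dom i ∧ ∀ l, avail z l → G z i ≤ G z l}
  obtain ⟨z, hz0, hzs, hz⟩ := exists_forall_mem_closure_of_cover (S := n * R) (by positivity) A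
    (by
      classical
      intro z hz0 _
      obtain ⟨i, hi, hmin⟩ := Finset.exists_min_image (Finset.univ.filter (avail z)) (G z)
        ⟨Sum.inl ⟨0, hm⟩, by simp [avail]⟩
      exact ⟨i, ⟨hz0, (Finset.mem_filter.1 hi).2⟩, fun l hl => hmin l (by simpa using hl)⟩)
  have hdom_closed : ∀ l, IsClosed {z | avail z l} := by
    rintro (i | j)
    · simp [avail]
    · exact isClosed_le (by fun_prop) continuous_const
  -- Availability is closed, so lying in the closure of `A i` already forces the bids to be
  -- nonnegative.
  have havail : ∀ i, 0 < z i → avail z i := fun i hi =>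
    closure_minimal (fun w hw => hw.1.2) (hdom_closed i) (hz i hi)
  -- Price comparisons pass to the limit along a sequence in `A i`, provided `l` stays available
  -- near `z`; for a bid this is what `0 < y j` ensures.
  have hle : ∀ i l, 0 < z i → (∀ᶠ w in 𝓝 z, avail w l) → G z i ≤ G z l := by
    intro i l hi hl
    obtain ⟨w, hwA, hw⟩ := mem_closure_iff_seq_limit.1 (hz i hi)
    have hwl : ∀ᶠ k in atTop, avail (w k) l := hw.eventually hl
    have h1 : Tendsto (fun k => G (w k) i) atTop (𝓝 (G z i)) :=
      (hG i z ⟨hz0, havail i hi⟩).tendsto.comp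
        (tendsto_nhdsWithin_iff.2 ⟨hw, Eventually.of_forall fun k => (hwA k).1⟩)
    have h2 : Tendsto (fun k => G (w k) l) atTop (𝓝 (G z l)) :=
      (hG l z ⟨hz0, hl.self_of_nhds⟩).tendsto.comp
        (tendsto_nhdsWithin_iff.2 ⟨hw, hwl.mono fun k hk => ⟨(hwA k).1.1, hk⟩⟩)
    exact le_of_tendsto_of_tendsto h1 h2 (hwl.mono fun k hk => (hwA k).2 l hk)
  have hinl : ∀ i : Fin m, ∀ᶠ w in 𝓝 z, avail w (Sum.inl i) := fun i =>
    Eventually.of_forall fun _ => trivial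
  refine ⟨fun i => z (Sum.inl i), fun j => R - z (Sum.inr j), hunb.mem_D.2
    ⟨fun i => hz0 _, fun j => ?_, ?_⟩, fun j => by linarith [hz0 (Sum.inr j)],
    fun i k hi => hle _ (Sum.inl k) hi (hinl k), fun i j hi hj => hle _ (Sum.inr j) hi ?_,
    fun i j hj => hle (Sum.inr j) _ (by linarith) (hinl i)⟩
  · rcases (hz0 (Sum.inr j)).eq_or_lt with h | h
    · rw [← h]; simpa using hR
    · exact sub_nonneg.2 (havail _ h)
  · rw [Fintype.sum_sum_type] at hzs
    simp only [Finset.sum_sub_distrib, Finset.sum_const, Finset.card_univ, Fintype.card_fin,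
      nsmul_eq_mul]
    linarith
  · have : ∀ᶠ w in 𝓝 z, w (Sum.inr j) < R :=
      (continuous_apply (Sum.inr j)).continuousAt.eventually_lt_const (by simpa using hj)
    exact this.mono fun _ h => h.le

end WirelessMarket

theorem theorem6p1 {m n : ℕ} (P : WirelessMarket m n)
    (hunb : P.Unbounded)
    (hD : P.D.Nonempty)
    (hg : ∀ i, ContinuousOn (P.g i) P.offerBox)
    (hh : ∀ j, ContinuousOn (P.h j) (P.bidSegment j))
    (hC2 : P.Coercive) :
    ∃ x' y', P.SolvesVI x' y' := by
  rcases Nat.eq_zero_or_pos m with rfl | hm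
  · obtain ⟨⟨x', y'⟩, hD'⟩ := hD
    -- Without providers the balance equation kills all bids and both sums vanish.
    have hzero : ∀ x y, (x, y) ∈ P.D → ∀ j, y j = 0 := by
      intro x y hxy j
      obtain ⟨-, hy, hs⟩ := hunb.mem_D.1 hxy
      rw [Finset.univ_eq_empty, Finset.sum_empty] at hs
      exact (Finset.sum_eq_zero_iff_of_nonneg fun j _ => hy j).1 hs.symm j (Finset.mem_univ j)
    exact ⟨x', y', hD', fun x y hxy => by simp [hzero x y hxy, hzero x' y' hD']⟩
  obtain ⟨r, hr, hcoer⟩ := hC2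
  -- Taking `r + 1` places bids at the truncation level strictly above `r`, where coercivity
  -- applies.
  obtain ⟨x, y, hxy, hyR, hgg, hgh, hhg⟩ :=
    hunb.exists_truncated_equilibrium hm hg hh (R := r + 1) (by linarith)
  have : Nonempty (Fin m) := ⟨⟨0, hm⟩⟩
  -- The least offer price is the clearing price.
  obtain ⟨k, hk⟩ := Finite.exists_min fun i => P.g i x
  refine ⟨x, y, hunb.solvesVI_of_price hxy (P.g k x) hk (fun i hi => hgg i k hi) (fun j => ?_)
    fun j hj => ?_⟩
  · rcases (hyR j).eq_or_lt with h | h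
    · obtain ⟨i, hi, hgi⟩ := hcoer x y hxy j (by linarith)
      exact hgi.trans (hgg i k hi)
    · exact hhg k j h
  · obtain ⟨hx, hy, hs⟩ := hunb.mem_D.1 hxy
    have hpos : 0 < ∑ i, x i :=
      hs ▸ hj.trans_le (Finset.single_le_sum (fun j _ => hy j) (Finset.mem_univ j))
    obtain ⟨i, -, hi⟩ := Finset.exists_lt_of_sum_lt (s := Finset.univ) (f := fun _ => (0 : ℝ))
      (g := x) (by simpa using hpos)
    exact (hk i).trans (hgh i j hi hj)
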